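/- Let $p>1$ and let $N>1$ be an integer. Let $f\colon\mathbb{R}\to\mathbb{R}$ be a positive, nonincreasing, continuous function satisfying $$\int_{-\infty}^{-1}\left(\int_t^{-1} f(s)\,ds\right)^{-1/p}dt<+\infty .$$ Then the inequality $$-\operatorname{div}\left(|\nabla u|^{p-2}\nabla u\right)\ge f(u)\quad\text{on }\mathbb{R}^N$$ has no weak $C^1$ solutions; that is, there is no function $u\in C^1(\mathbb{R}^N)$ such that for every nonnegative compactly supported $\varphi\in C^1(\mathbb{R}^N)$ $$\int_{\mathbb{R}^N}|\nabla u|^{p-2}\nabla u\cdot\nabla\varphi\,dx\ \ge\ \int_{\mathbb{R}^N} f(u)\,\varphi\,dx ,$$ where $|\nabla u|^{p-2}\nabla u$ is understood as $0$ at points where $\nabla u=0$. -/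

import Mathlib

open MeasureTheory

/-- The Keller–Osserman condition at `-∞` for the exponent `p`:
`∫_{-∞}^{-1} (∫_t^{-1} f(s) ds)^{-1/p} dt < +∞`. -/
def KellerOssermanAtBot (p : ℝ) (f : ℝ → ℝ) : Prop :=
  IntegrableOn (fun t : ℝ => (∫ s in t..(-1 : ℝ), f s) ^ (-(1 / p))) (Set.Iio (-1 : ℝ)) volume

/-- The field `|∇u|^{p-2} ∇u`, with the value `0` where `∇u = 0`. -/
noncomputable def pLaplaceFlux {N : ℕ} (p : ℝ) (u : EuclideanSpace ℝ (Fin N) → ℝ)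
    (x : EuclideanSpace ℝ (Fin N)) : EuclideanSpace ℝ (Fin N) :=
  ‖gradient u x‖ ^ (p - 2) • gradient u x

/-- `u` is a weak `C¹` solution of `-div(|∇u|^{p-2} ∇u) ≥ f(u)` on `ℝ^N`: it is of class `C¹` and
`∫ |∇u|^{p-2} ∇u · ∇φ ≥ ∫ f(u) φ` for every nonnegative compactly supported `C¹` function `φ`. -/
def IsWeakSolutionPLaplaceGE {N : ℕ} (p : ℝ) (f : ℝ → ℝ)
    (u : EuclideanSpace ℝ (Fin N) → ℝ) : Prop :=
  ContDiff ℝ 1 u ∧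
    ∀ φ : EuclideanSpace ℝ (Fin N) → ℝ, ContDiff ℝ 1 φ → HasCompactSupport φ → (∀ x, 0 ≤ φ x) →
      ∫ x, f (u x) * φ x ≤ ∫ x, inner ℝ (pLaplaceFlux p u x) (gradient φ x)

open Set Filter Topology

namespace KellerOsserman

/-! A solution `u` is compared with a radial barrier `v` such that `v 0 = a > u 0` and `v` lies
below `u` near the boundary of a large ball; comparison then gives `v 0 ≤ u 0`, a contradiction. The
profile solves the autonomous equation `V' = -(c ∫_V^a g)^{1/p}` with `c = p / ((p-1)N)`, chosen so
that `|V'|^{p-1} = ∫_0^r g(V)/N` (`exists_profile`, `integral_comp_profile`). The flux of `v =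
V(‖x‖)` is then `-H x`, where `H` is the mean of `y = g(V)/N` over `[0, ‖x‖]`. As `y` is
nondecreasing, `H ≤ y`, so `div (H x) = (N-1)H + y ≤ N y = g(v)`: `v` is a subsolution
(`integral_inner_radial_le`). The radius at which `V` reaches height `b` is at most `∫_b^a (c ∫_t^a
g)^{-1/p} dt`, and Keller–Osserman bounds this for `g = f` uniformly in `b` (`exists_radius`). Hence
`b` may be chosen after the ball, below the minimum of `u` there. Replacing `f` by `f(max t b)`
makes `V` global and changes nothing above height `b`. The comparison (`le_of_weak_comparison`)
tests with `((v-u)⁺)²`. -/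

lemma hasDerivAt_integral_left {g : ℝ → ℝ} (hg : Continuous g) (a t : ℝ) :
    HasDerivAt (fun t => ∫ s in t..a, g s) (-g t) t := by
  have h := (hg.integral_hasStrictDerivAt a t).hasDerivAt.neg
  refine h.congr_of_eventuallyEq (Eventually.of_forall fun x => ?_)
  exact intervalIntegral.integral_symm _ _

lemma mul_sub_le_integral {g : ℝ → ℝ} (hg : Continuous g) (hanti : Antitone g) {a t : ℝ}
    (ht : t ≤ a) : g a * (a - t) ≤ ∫ s in t..a, g s := by
  have := intervalIntegral.integral_mono_on (μ := volume) ht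
    (continuous_const.intervalIntegrable t a) (hg.intervalIntegrable t a)
    (fun x hx => hanti hx.2)
  simpa [mul_comm] using this

lemma integral_le_mul_sub {g : ℝ → ℝ} (hg : Continuous g) {M : ℝ} (hM : ∀ t, g t ≤ M) {a t : ℝ}
    (ht : t ≤ a) : ∫ s in t..a, g s ≤ M * (a - t) := by
  have := intervalIntegral.integral_mono_on (μ := volume) ht (hg.intervalIntegrable t a)
    (continuous_const.intervalIntegrable t a) (fun x _ => hM x)
  simpa [mul_comm] using this

lemma integral_left_pos {g : ℝ → ℝ} (hg : Continuous g) (hanti : Antitone g)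
    (hpos : ∀ t, 0 < g t) {a t : ℝ} (ht : t < a) : 0 < ∫ s in t..a, g s :=
  lt_of_lt_of_le (mul_pos (hpos a) (sub_pos.2 ht)) (mul_sub_le_integral hg hanti ht.le)

/-- The reciprocal of the slope `(c ∫_t^a g)^{1/p}` of the radial barrier at height `t`,
continued by `1` above the top height `a`. -/
noncomputable def invSlope (p c a : ℝ) (g : ℝ → ℝ) (t : ℝ) : ℝ :=
  if t < a then (c * ∫ s in t..a, g s) ^ (-(1 / p)) else 1

/-! ### Integrating the reciprocal slope -/

section invSlope

variable {p c a : ℝ} {g : ℝ → ℝ}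

lemma invSlope_of_lt {t : ℝ} (ht : t < a) :
    invSlope p c a g t = (c * ∫ s in t..a, g s) ^ (-(1 / p)) := if_pos ht

lemma invSlope_of_le {t : ℝ} (ht : a ≤ t) : invSlope p c a g t = 1 := if_neg ht.not_gt

lemma invSlope_pos (hc : 0 < c) (hg : Continuous g) (hanti : Antitone g) (hpos : ∀ t, 0 < g t)
    (t : ℝ) : 0 < invSlope p c a g t := by
  rcases lt_or_ge t a with h | h
  · rw [invSlope_of_lt h]
    exact Real.rpow_pos_of_pos (mul_pos hc (integral_left_pos hg hanti hpos h)) _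
  · simp [invSlope_of_le h]

lemma continuous_integral_left (hg : Continuous g) : Continuous fun t => ∫ s in t..a, g s :=
  continuous_iff_continuousAt.2 fun t => (hasDerivAt_integral_left hg a t).continuousAt

lemma measurable_invSlope (hg : Continuous g) : Measurable (invSlope p c a g) := by
  refine Measurable.ite measurableSet_Iio ?_ measurable_const
  exact (((continuous_integral_left hg).measurable).const_mul c).pow_const _

lemma continuousAt_invSlope (hc : 0 < c) (hg : Continuous g) (hanti : Antitone g)
    (hpos : ∀ t, 0 < g t) {t : ℝ} (ht : t < a) : ContinuousAt (invSlope p c a g) t := by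
  have h1 : ContinuousAt (fun t => (c * ∫ s in t..a, g s) ^ (-(1 / p))) t :=
    ((continuous_integral_left hg).continuousAt.const_mul c).rpow_const
      (Or.inl (mul_pos hc (integral_left_pos hg hanti hpos ht)).ne')
  refine h1.congr ?_
  filter_upwards [Iio_mem_nhds ht] with s hs
  exact (invSlope_of_lt hs).symm

/-- Since `∫_t^a g ≥ g(a)(a - t)`, the integrand is at most a multiple of `(a - t)^{-1/p}`,
integrable because `p > 1`. This is why a solution can leave the equilibrium `a`. -/
lemma intervalIntegrable_integral_rpow (hp : 1 < p) (hc : 0 < c) (hg : Continuous g)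
    (hanti : Antitone g) (hpos : ∀ t, 0 < g t) (t : ℝ) (ht : t ≤ a) :
    IntervalIntegrable (fun t => (c * ∫ s in t..a, g s) ^ (-(1 / p))) volume t a := by
  have hr : (-1 : ℝ) < -(1 / p) := by
    have : 1 / p < 1 := by rw [div_lt_one (by linarith)]; exact hp
    linarith
  have h0 := ((intervalIntegral.intervalIntegrable_rpow' (a := a - t) (b := 0) hr).const_mul
    ((c * g a) ^ (-(1 / p)))).comp_sub_left a
  simp only [sub_sub_cancel, sub_zero] at h0
  refine h0.mono_fun
    (((continuous_integral_left hg).measurable.const_mul c).pow_const _).aestronglyMeasurable ?_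
  rw [uIoc_of_le ht, EventuallyLE, ae_restrict_iff' measurableSet_Ioc]
  have hne : ∀ᵐ x : ℝ, x ≠ a := by simp [ae_iff]
  filter_upwards [hne] with x hxa hx
  have hx' : x < a := lt_of_le_of_ne hx.2 hxa
  have hF := mul_sub_le_integral hg hanti hx'.le
  have h1 : 0 < g a * (a - x) := mul_pos (hpos a) (sub_pos.2 hx')
  have h2 : 0 < c * g a := mul_pos hc (hpos a)
  rw [Real.norm_of_nonneg (Real.rpow_nonneg (by nlinarith) _),
    Real.norm_of_nonneg (by
      have := sub_pos.2 hx'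
      positivity), ← Real.mul_rpow h2.le (sub_pos.2 hx').le]
  refine Real.rpow_le_rpow_of_nonpos (by nlinarith) (by nlinarith) ?_
  have : 0 < 1 / p := by positivity
  linarith

lemma intervalIntegrable_invSlope_of_le (hp : 1 < p) (hc : 0 < c) (hg : Continuous g)
    (hanti : Antitone g) (hpos : ∀ t, 0 < g t) (t : ℝ) (ht : t ≤ a) :
    IntervalIntegrable (invSlope p c a g) volume t a := by
  refine (intervalIntegrable_integral_rpow hp hc hg hanti hpos t ht).congr_ae ?_
  rw [uIoc_of_le ht, EventuallyEq, ae_restrict_iff' measurableSet_Ioc]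
  have hne : ∀ᵐ x : ℝ, x ≠ a := by simp [ae_iff]
  filter_upwards [hne] with x hxa hx
  exact (invSlope_of_lt (lt_of_le_of_ne hx.2 hxa)).symm

lemma intervalIntegrable_invSlope (hp : 1 < p) (hc : 0 < c) (hg : Continuous g)
    (hanti : Antitone g) (hpos : ∀ t, 0 < g t) (x y : ℝ) :
    IntervalIntegrable (invSlope p c a g) volume x y := by
  have key : ∀ t, IntervalIntegrable (invSlope p c a g) volume t a := by
    intro t
    rcases le_total t a with h | h
    · exact intervalIntegrable_invSlope_of_le hp hc hg hanti hpos t h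
    · refine (intervalIntegrable_const (c := (1 : ℝ))).congr_ae ?_
      rw [uIoc_of_ge h, EventuallyEq, ae_restrict_iff' measurableSet_Ioc]
      exact Eventually.of_forall fun x hx => (invSlope_of_le hx.1.le).symm
  exact (key x).trans (key y).symm

lemma strictMono_integral_invSlope (hp : 1 < p) (hc : 0 < c) (hg : Continuous g)
    (hanti : Antitone g) (hpos : ∀ t, 0 < g t) :
    StrictMono fun t => ∫ s in a..t, invSlope p c a g s := by
  intro x y hxy
  have hI := intervalIntegrable_invSlope (a := a) hp hc hg hanti hpos
  have h := intervalIntegral.intervalIntegral_pos_of_pos (hI x y)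
    (invSlope_pos hc hg hanti hpos) hxy
  have := intervalIntegral.integral_add_adjacent_intervals (hI a x) (hI x y)
  simp only
  linarith

lemma continuous_integral_invSlope (hp : 1 < p) (hc : 0 < c) (hg : Continuous g)
    (hanti : Antitone g) (hpos : ∀ t, 0 < g t) :
    Continuous fun t => ∫ s in a..t, invSlope p c a g s :=
  intervalIntegral.continuous_primitive (intervalIntegrable_invSlope hp hc hg hanti hpos) a

/-- Boundedness of `g` gives `∫_t^a g ≤ M(a - t)`, so the integral down to `t` grows at least like
`(a - t)^{1-1/p}`. The profile therefore cannot reach `-∞` at a finite radius. -/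
lemma surjective_integral_invSlope (hp : 1 < p) (hc : 0 < c) (hg : Continuous g)
    (hanti : Antitone g) (hpos : ∀ t, 0 < g t) {M : ℝ} (hM : ∀ t, g t ≤ M) :
    Function.Surjective fun t => ∫ s in a..t, invSlope p c a g s := by
  have hI := intervalIntegrable_invSlope (a := a) hp hc hg hanti hpos
  have hM0 : 0 < M := (hpos 0).trans_le (hM 0)
  have hp0 : 0 < 1 / p := by positivity
  have hp1 : 1 / p < 1 := by rw [div_lt_one (by linarith)]; exact hp
  refine (continuous_integral_invSlope hp hc hg hanti hpos).surjective ?_ ?_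
  · refine (tendsto_atTop_add_const_right _ (-a) tendsto_id).congr' ?_
    filter_upwards [eventually_ge_atTop a] with t ht
    rw [intervalIntegral.integral_congr (g := fun _ => (1 : ℝ))]
    · simp [sub_eq_add_neg]
    · intro x hx
      rw [uIcc_of_le ht] at hx
      exact invSlope_of_le hx.1
  · have h1 : Tendsto (fun t : ℝ => a - t) atBot atTop :=
      tendsto_atTop_add_const_left _ a tendsto_neg_atBot_atTop
    have h2 : Tendsto (fun t : ℝ => (c * M) ^ (-(1 / p)) * (a - t) ^ (1 - 1 / p)) atBot atTop :=
      (((tendsto_rpow_atTop (sub_pos.2 hp1)).comp h1).const_mul_atTop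
        (Real.rpow_pos_of_pos (mul_pos hc hM0) _))
    refine tendsto_atBot_mono' _ ?_ (tendsto_neg_atTop_atBot.comp h2)
    filter_upwards [eventually_lt_atBot a] with t ht
    have hat : 0 < a - t := sub_pos.2 ht
    rw [Function.comp_apply, intervalIntegral.integral_symm, neg_le_neg_iff]
    have h3 := intervalIntegral.integral_mono_on_of_le_Ioo (μ := volume)
      (f := fun _ => (c * (M * (a - t))) ^ (-(1 / p))) ht.le
      intervalIntegrable_const (hI t a) (fun x hx => by
        rw [invSlope_of_lt hx.2]
        have hF := integral_left_pos hg hanti hpos hx.2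
        have hF2 := integral_le_mul_sub hg hM hx.2.le
        have : M * (a - x) ≤ M * (a - t) := by
          apply mul_le_mul_of_nonneg_left _ hM0.le
          linarith [hx.1]
        exact Real.rpow_le_rpow_of_nonpos (mul_pos hc hF)
          (mul_le_mul_of_nonneg_left (hF2.trans this) hc.le) (by linarith))
    refine le_trans (le_of_eq ?_) h3
    rw [intervalIntegral.integral_const, smul_eq_mul, ← mul_assoc,
      Real.mul_rpow (mul_pos hc hM0).le hat.le, sub_eq_add_neg (1 : ℝ), Real.rpow_add hat,
      Real.rpow_one]
    ring

lemma hasDerivAt_integral_invSlope (hp : 1 < p) (hc : 0 < c) (hg : Continuous g)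
    (hanti : Antitone g) (hpos : ∀ t, 0 < g t) {t : ℝ} (ht : t < a) :
    HasDerivAt (fun t => ∫ s in a..t, invSlope p c a g s) (invSlope p c a g t) t :=
  intervalIntegral.integral_hasDerivAt_right
    (intervalIntegrable_invSlope hp hc hg hanti hpos a t)
    ((measurable_invSlope hg).stronglyMeasurable.stronglyMeasurableAtFilter)
    (continuousAt_invSlope hc hg hanti hpos ht)

end invSlope

/-! ### The radial profile and its flux -/

/-- The profile of the radial barrier: for a bounded positive nonincreasing `g`, a global solution
of `V' = -(c ∫_V^a g)^{1/p}` on `[0, ∞)` leaving the equilibrium `a` immediately. -/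
theorem exists_profile {p c a : ℝ} {g : ℝ → ℝ} (hp : 1 < p) (hc : 0 < c) (hg : Continuous g)
    (hanti : Antitone g) (hpos : ∀ t, 0 < g t) {M : ℝ} (hM : ∀ t, g t ≤ M) :
    ∃ V : ℝ → ℝ, Continuous V ∧ V 0 = a ∧ Antitone V ∧ (∀ r, 0 < r → V r < a) ∧
      (∀ r, HasDerivAt V (-(c * ∫ s in V r..a, g s) ^ (1 / p)) r) ∧
      ∀ b r, b ≤ a → ∫ t in b..a, (c * ∫ s in t..a, g s) ^ (-(1 / p)) ≤ r → V r ≤ b := by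
  have hp0 : 0 < 1 / p := by positivity
  have hmono := strictMono_integral_invSlope (a := a) hp hc hg hanti hpos
  have hsurj := surjective_integral_invSlope (a := a) hp hc hg hanti hpos hM
  set K : ℝ → ℝ := fun t => ∫ s in a..t, invSlope p c a g s with hK
  let e : ℝ ≃o ℝ := hmono.orderIsoOfSurjective K hsurj
  have hKa : K a = 0 := by simp [hK]
  have hKe : ∀ y, K (e.symm y) = y := fun y => e.apply_symm_apply y
  have heK : ∀ t, e.symm (K t) = t := fun t => e.symm_apply_apply t
  have he0 : e.symm 0 = a := by rw [← hKa, heK]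
  -- Separation of variables: `K (V r) = -r` for `r ≥ 0`. Freezing `V` at `a` for `r < 0` makes the
  -- equation hold on all of `ℝ`.
  set V : ℝ → ℝ := fun r => e.symm (-(max r 0)) with hV
  have hVc : Continuous V := e.symm.continuous.comp (by fun_prop)
  have hV0 : ∀ r, r ≤ 0 → V r = a := by
    intro r hr; simp [hV, max_eq_right hr, he0]
  have hVlt : ∀ r, 0 < r → V r < a := by
    intro r hr
    have : e.symm (-r) < e.symm 0 := e.symm.strictMono (by linarith)
    simpa [hV, max_eq_left hr.le, he0] using this
  have hVanti : Antitone V := by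
    intro x y hxy
    refine e.symm.monotone (neg_le_neg (max_le_max hxy le_rfl))
  have hqc : Continuous fun t => -(c * ∫ s in t..a, g s) ^ (1 / p) :=
    (((continuous_integral_left hg).const_mul c).rpow_const fun _ => Or.inr hp0.le).neg
  have hder : ∀ r, r ≠ 0 → HasDerivAt V (-(c * ∫ s in V r..a, g s) ^ (1 / p)) r := by
    intro r hr
    rcases hr.lt_or_gt with hr | hr
    · rw [hV0 r hr.le, intervalIntegral.integral_same, mul_zero, Real.zero_rpow hp0.ne', neg_zero]
      refine (hasDerivAt_const r a).congr_of_eventuallyEq ?_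
      filter_upwards [Iio_mem_nhds hr] with x hx
      exact hV0 x (le_of_lt hx)
    · have hlt := hVlt r hr
      have h1 := hasDerivAt_integral_invSlope (a := a) hp hc hg hanti hpos hlt
      have hVr : V r = e.symm (-r) := by simp [hV, max_eq_left hr.le]
      have h2 : HasDerivAt e.symm (invSlope p c a g (V r))⁻¹ (-r) := by
        refine HasDerivAt.of_local_left_inverse e.symm.continuous.continuousAt (f := K) ?_
          (invSlope_pos hc hg hanti hpos _).ne' (Eventually.of_forall hKe)
        rw [← hVr]; exact h1
      have h3 := h2.comp r (hasDerivAt_neg r)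
      have hF := mul_pos hc (integral_left_pos hg hanti hpos hlt)
      rw [invSlope_of_lt hlt, Real.rpow_neg hF.le, inv_inv, mul_neg_one] at h3
      refine h3.congr_of_eventuallyEq ?_
      filter_upwards [Ioi_mem_nhds hr] with x hx
      simp [hV, max_eq_left (le_of_lt (mem_Ioi.1 hx))]
  refine ⟨V, hVc, hV0 0 le_rfl, hVanti, hVlt, fun r => ?_, ?_⟩
  · rcases eq_or_ne r 0 with rfl | hr
    -- The inverse function rule fails here, as the reciprocal slope blows up at `a`; the derivative
    -- is the limit of nearby derivatives.
    · exact hasDerivAt_of_hasDerivAt_of_ne (x := 0)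
        (g := fun r => -(c * ∫ s in V r..a, g s) ^ (1 / p)) hder hVc.continuousAt
        (hqc.comp hVc).continuousAt
    · exact hder r hr
  · intro b r hb hr
    have h1 : ∫ t in b..a, (c * ∫ s in t..a, g s) ^ (-(1 / p)) = -K b := by
      rw [hK]
      simp only
      rw [intervalIntegral.integral_symm, neg_inj, intervalIntegral.integral_symm b a,
        intervalIntegral.integral_symm b a, neg_inj]
      refine intervalIntegral.integral_congr_ae ?_
      have hne : ∀ᵐ x : ℝ, x ≠ a := by simp [ae_iff]
      filter_upwards [hne] with x hxa hx
      rw [uIoc_of_le hb] at hx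
      exact (invSlope_of_lt (lt_of_le_of_ne hx.2 hxa)).symm
    rw [h1] at hr
    calc V r ≤ e.symm (K b) := e.symm.monotone (by
          have := le_max_left r 0
          linarith)
      _ = b := heK b

/-- The flux `|V'|^{p-1}` of the profile is an antiderivative of `g ∘ V / n`. -/
lemma integral_comp_profile {p n a : ℝ} {g V : ℝ → ℝ} (hp : 1 < p) (hn : 0 < n)
    (hg : Continuous g) (hanti : Antitone g) (hpos : ∀ t, 0 < g t)
    (hVc : Continuous V) (hV0 : V 0 = a) (hVlt : ∀ r, 0 < r → V r < a)
    (hV : ∀ r, HasDerivAt V (-(p / ((p - 1) * n) * ∫ s in V r..a, g s) ^ (1 / p)) r)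
    {r : ℝ} (hr : 0 ≤ r) :
    ∫ s in (0 : ℝ)..r, g (V s) / n =
      ((p / ((p - 1) * n) * ∫ s in V r..a, g s) ^ (1 / p)) ^ (p - 1) := by
  have hp0 : 0 < 1 / p := by positivity
  have hp1 : 0 < p - 1 := by linarith
  have hc : 0 < p / ((p - 1) * n) := by positivity
  set c := p / ((p - 1) * n) with hcdef
  have hcont : Continuous fun r => ((c * ∫ s in V r..a, g s) ^ (1 / p)) ^ (p - 1) :=
    ((((continuous_integral_left hg).comp hVc).const_mul c).rpow_const
      fun _ => Or.inr hp0.le).rpow_const fun _ => Or.inr hp1.le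
  have h := intervalIntegral.integral_eq_sub_of_hasDerivAt_of_le
    (f := fun r => ((c * ∫ s in V r..a, g s) ^ (1 / p)) ^ (p - 1))
    (f' := fun s => g (V s) / n) hr hcont.continuousOn ?_
    (((hg.comp hVc).div_const n).intervalIntegrable 0 r)
  · rw [h]
    simp [hV0, Real.zero_rpow hp1.ne', Real.zero_rpow (inv_pos.2 (by linarith : 0 < p)).ne']
  · intro x hx
    have hF := mul_pos hc (integral_left_pos hg hanti hpos (hVlt x hx.1))
    have h1 := (((hasDerivAt_integral_left hg a (V x)).comp x (hV x)).const_mul c).rpow_const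
      (p := 1 / p) (Or.inl hF.ne')
    have h2 := h1.rpow_const (p := p - 1) (Or.inl (Real.rpow_pos_of_pos hF _).ne')
    refine h2.congr_deriv ?_
    simp only [Function.comp_apply]
    set y := c * ∫ s in V x..a, g s with hy
    have e1 : y ^ (1 / p) * y ^ (1 / p - 1) * (y ^ (1 / p)) ^ (p - 1 - 1) = 1 := by
      rw [← Real.rpow_mul hF.le, ← Real.rpow_add hF, ← Real.rpow_add hF]
      rw [show 1 / p + (1 / p - 1) + 1 / p * (p - 1 - 1) = 0 by field_simp; ring, Real.rpow_zero]
    -- This identity dictates the value of `c`.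
    have e2 : c * (1 / p) * (p - 1) = 1 / n := by
      rw [hcdef]; field_simp
    calc _ = g (V x) * (c * (1 / p) * (p - 1)) *
          (y ^ (1 / p) * y ^ (1 / p - 1) * (y ^ (1 / p)) ^ (p - 1 - 1)) := by ring
      _ = _ := by rw [e1, e2]; ring

/-! ### Radial functions and their gradients -/

section norm

variable {E : Type*} [NormedAddCommGroup E] [InnerProductSpace ℝ E]

lemma hasFDerivAt_norm {x : E} (hx : x ≠ 0) :
    HasFDerivAt (fun x : E => ‖x‖) (‖x‖⁻¹ • innerSL ℝ x) x := by
  have hx' : ‖x‖ ≠ 0 := norm_ne_zero_iff.2 hx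
  have h := (hasStrictFDerivAt_norm_sq x).hasFDerivAt.sqrt (by positivity)
  simp only [Real.sqrt_sq (norm_nonneg _)] at h
  refine h.congr_fderiv ?_
  ext v
  simp
  field_simp

lemma continuous_radial_field {w : ℝ → ℝ} (hwc : Continuous w) (hw : w 0 = 0) :
    Continuous fun x : E => -(w ‖x‖ / ‖x‖) • x := by
  refine continuous_iff_continuousAt.2 fun x => ?_
  rcases eq_or_ne x 0 with rfl | hx
  · rw [ContinuousAt, smul_zero, tendsto_zero_iff_norm_tendsto_zero]
    have h1 : Tendsto (fun x : E => |w ‖x‖|) (𝓝 0) (𝓝 0) := by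
      have : Continuous fun x : E => |w ‖x‖| := by fun_prop
      simpa [hw] using this.tendsto 0
    refine squeeze_zero (fun _ => norm_nonneg _) (fun y => ?_) h1
    rw [norm_smul, norm_neg, norm_div, norm_norm, Real.norm_eq_abs]
    rcases eq_or_ne ‖y‖ 0 with h | h
    · simp [h]
    · rw [div_mul_cancel₀ _ h]
  · have hx' : ‖x‖ ≠ 0 := norm_ne_zero_iff.2 hx
    refine ContinuousAt.smul (ContinuousAt.neg (ContinuousAt.div ?_ ?_ hx')) continuousAt_id
    · exact (hwc.comp continuous_norm).continuousAt
    · exact continuous_norm.continuousAt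

variable [CompleteSpace E]

/-- The gradient of a radial function whose profile is flat at the origin. -/
lemma hasGradientAt_comp_norm {V w : ℝ → ℝ} (hV : ∀ r, HasDerivAt V (-w r) r) (hw : w 0 = 0)
    (x : E) : HasGradientAt (fun x : E => V ‖x‖) (-(w ‖x‖ / ‖x‖) • x) x := by
  rw [hasGradientAt_iff_hasFDerivAt]
  rcases eq_or_ne x 0 with rfl | hx
  · have h := hV 0
    rw [hw, neg_zero, hasDerivAt_iff_isLittleO_nhds_zero] at h
    rw [smul_zero, map_zero, hasFDerivAt_iff_isLittleO_nhds_zero]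
    have h2 := (h.comp_tendsto (tendsto_norm_zero (E := E)))
    rw [← Asymptotics.isLittleO_norm_right]
    simpa [Function.comp_def] using h2
  · refine ((hV ‖x‖).comp_hasFDerivAt x (hasFDerivAt_norm hx)).congr_fderiv ?_
    ext v
    simp
    ring

lemma contDiff_one_of_hasGradientAt {f : E → ℝ} {G : E → E} (hf : ∀ x, HasGradientAt f (G x) x)
    (hG : Continuous G) : ContDiff ℝ 1 f := by
  rw [contDiff_one_iff_fderiv]
  refine ⟨fun x => (hf x).differentiableAt, ?_⟩
  have : fderiv ℝ f = fun x => InnerProductSpace.toDual ℝ E (G x) :=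
    funext fun x => (hf x).hasFDerivAt.fderiv
  rw [this]
  exact (InnerProductSpace.toDual ℝ E).continuous.comp hG

lemma continuous_gradient {f : E → ℝ} (hf : ContDiff ℝ 1 f) : Continuous (gradient f) :=
  (InnerProductSpace.toDual ℝ E).symm.continuous.comp (hf.continuous_fderiv one_ne_zero)

end norm

/-! ### Divergence of radial fields -/

/-- The mean value `r⁻¹ ∫_0^r y`, with value `y 0` at `r = 0`. -/
noncomputable def meanValue (y : ℝ → ℝ) : ℝ → ℝ := dslope (fun r => ∫ s in (0 : ℝ)..r, y s) 0

section meanValue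

variable {y : ℝ → ℝ}

lemma mul_meanValue (r : ℝ) : r * meanValue y r = ∫ s in (0 : ℝ)..r, y s := by
  simpa [meanValue] using sub_smul_dslope (fun r => ∫ s in (0 : ℝ)..r, y s) 0 r

lemma meanValue_eq_div {r : ℝ} (hr : r ≠ 0) :
    meanValue y r = (∫ s in (0 : ℝ)..r, y s) / r := by
  rw [← mul_meanValue, mul_div_cancel_left₀ _ hr]

lemma meanValue_zero (hy : Continuous y) : meanValue y 0 = y 0 := by
  rw [meanValue, dslope_same, hy.deriv_integral]

lemma continuous_meanValue (hy : Continuous y) : Continuous (meanValue y) := by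
  have hd : Differentiable ℝ fun r => ∫ s in (0 : ℝ)..r, y s := fun r =>
    (hy.integral_hasStrictDerivAt 0 r).hasDerivAt.differentiableAt
  refine continuous_iff_continuousAt.2 fun r => ?_
  rcases eq_or_ne r 0 with rfl | hr
  · exact continuousAt_dslope_same.2 (hd 0)
  · exact (continuousAt_dslope_of_ne hr).2 (hd r).continuousAt

lemma hasDerivAt_meanValue (hy : Continuous y) {r : ℝ} (hr : r ≠ 0) :
    HasDerivAt (meanValue y) ((y r - meanValue y r) / r) r := by
  have h := ((hy.integral_hasStrictDerivAt 0 r).hasDerivAt).div (hasDerivAt_id r) hr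
  have h2 : HasDerivAt (meanValue y) _ r := h.congr_of_eventuallyEq (by
    filter_upwards [isOpen_ne.mem_nhds hr] with s hs
    exact meanValue_eq_div hs)
  refine h2.congr_deriv ?_
  rw [meanValue_eq_div hr]
  simp only [id]
  field_simp

lemma meanValue_le (hy : Continuous y) (hmono : Monotone y) {r : ℝ} (hr : 0 ≤ r) :
    meanValue y r ≤ y r := by
  rcases hr.eq_or_lt with rfl | hr'
  · rw [meanValue_zero hy]
  · rw [meanValue_eq_div hr'.ne', div_le_iff₀ hr']
    have := intervalIntegral.integral_mono_on (μ := volume) hr (hy.intervalIntegrable 0 r)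
      (intervalIntegrable_const (c := y r)) (fun x hx => hmono hx.2)
    simpa [mul_comm] using this

variable {N : ℕ}

/-- The `i`-th diagonal partial derivative of the radial field `x ↦ meanValue y ‖x‖ • x`. -/
lemma hasLineDerivAt_meanValue_norm_mul (hy : Continuous y) (x : EuclideanSpace ℝ (Fin N))
    (i : Fin N) :
    HasLineDerivAt ℝ (fun x : EuclideanSpace ℝ (Fin N) => meanValue y ‖x‖ * x i)
      (meanValue y ‖x‖ + (y ‖x‖ - meanValue y ‖x‖) * (x i ^ 2 / ‖x‖ ^ 2)) x
      (EuclideanSpace.single i (1 : ℝ)) := by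
  rcases eq_or_ne x 0 with rfl | hx
  -- At the origin the quotient `x i ^ 2 / ‖x‖ ^ 2` is `0 / 0 = 0`, so the claimed value is
  -- `meanValue y 0`, the limit of the slopes `meanValue y |t|`.
  · rw [HasLineDerivAt, hasDerivAt_iff_tendsto_slope]
    have hc : Continuous fun t : ℝ => meanValue y |t| :=
      (continuous_meanValue hy).comp continuous_abs
    have h0 : Tendsto (fun t : ℝ => meanValue y |t|) (𝓝[≠] 0) (𝓝 (meanValue y 0)) := by
      simpa using (hc.tendsto 0).mono_left nhdsWithin_le_nhds
    simp only [norm_zero, PiLp.zero_apply]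
    refine Tendsto.congr' ?_ (h0.trans (by simp))
    filter_upwards [self_mem_nhdsWithin] with t ht
    have ht : t ≠ 0 := ht
    simp [slope_def_field, norm_smul, ht]
  · have hx' : ‖x‖ ≠ 0 := norm_ne_zero_iff.2 hx
    have h1 := (hasDerivAt_meanValue hy hx').comp_hasFDerivAt x (hasFDerivAt_norm hx)
    have h2 : HasFDerivAt (fun x : EuclideanSpace ℝ (Fin N) => x i)
        (EuclideanSpace.proj i : EuclideanSpace ℝ (Fin N) →L[ℝ] ℝ) x :=
      (EuclideanSpace.proj i : EuclideanSpace ℝ (Fin N) →L[ℝ] ℝ).hasFDerivAt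
    have h3 := (h1.mul h2).hasLineDerivAt (EuclideanSpace.single i (1 : ℝ))
    have h4 : meanValue y ‖x‖ + (y ‖x‖ - meanValue y ‖x‖) * (x i ^ 2 / ‖x‖ ^ 2) =
        ((meanValue y ∘ norm) x • (EuclideanSpace.proj i : EuclideanSpace ℝ (Fin N) →L[ℝ] ℝ) +
          x i • ((y ‖x‖ - meanValue y ‖x‖) / ‖x‖) • ‖x‖⁻¹ • innerSL ℝ x)
          (EuclideanSpace.single i (1 : ℝ)) := by
      simp [EuclideanSpace.inner_single_right]
      ring
    rw [h4]
    exact h3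

/-- Integration by parts against a radial field: for nondecreasing `y`, the divergence of
`meanValue y ‖x‖ • x` is at most `N y`. -/
theorem integral_inner_radial_le (hN : 1 ≤ N) (hy : Continuous y) (hmono : Monotone y)
    {φ : EuclideanSpace ℝ (Fin N) → ℝ} (hφ : ContDiff ℝ 1 φ) (hφc : HasCompactSupport φ)
    (hφ0 : ∀ x, 0 ≤ φ x) :
    ∫ x, inner ℝ (-(meanValue y ‖x‖) • x) (gradient φ x) ≤ ∫ x, N * y ‖x‖ * φ x := by
  have hH := continuous_meanValue hy
  set H := meanValue y
  let e : Fin N → EuclideanSpace ℝ (Fin N) := fun i => EuclideanSpace.single i (1 : ℝ)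
  let D : Fin N → EuclideanSpace ℝ (Fin N) → ℝ := fun i x =>
    H ‖x‖ + (y ‖x‖ - H ‖x‖) * (x i ^ 2 / ‖x‖ ^ 2)
  have hdφ : Continuous (fderiv ℝ φ) := hφ.continuous_fderiv one_ne_zero
  have hdφc : ∀ v, HasCompactSupport fun x => fderiv ℝ φ x v := fun v =>
    hφc.fderiv_apply ℝ v
  have hcoord : ∀ i (x : EuclideanSpace ℝ (Fin N)), x i ^ 2 / ‖x‖ ^ 2 ≤ 1 := by
    intro i x
    refine div_le_one_of_le₀ ?_ (by positivity)
    rw [EuclideanSpace.real_norm_sq_eq]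
    exact Finset.single_le_sum (f := fun i => x i ^ 2) (fun _ _ => sq_nonneg _)
      (Finset.mem_univ i)
  -- `D i` may be discontinuous at the origin, so integrability comes from a continuous, compactly
  -- supported majorant.
  have hI1 : ∀ i, Integrable fun x : EuclideanSpace ℝ (Fin N) => D i x * φ x := by
    intro i
    have hB : Continuous fun x : EuclideanSpace ℝ (Fin N) =>
        (|H ‖x‖| + |y ‖x‖ - H ‖x‖|) * φ x := by
      have := hφ.continuous
      fun_prop
    refine (hB.integrable_of_hasCompactSupport hφc.mul_left).mono ?_ ?_
    · have h1 : Measurable fun x : EuclideanSpace ℝ (Fin N) => H ‖x‖ := by fun_prop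
      have h2 : Measurable fun x : EuclideanSpace ℝ (Fin N) => y ‖x‖ := by fun_prop
      have h3 : Measurable φ := hφ.continuous.measurable
      have h4 : Measurable fun x : EuclideanSpace ℝ (Fin N) => x i :=
        (by fun_prop : Continuous fun x : EuclideanSpace ℝ (Fin N) => x i).measurable
      exact ((h1.add ((h2.sub h1).mul ((h4.pow_const 2).div
        (measurable_norm.pow_const 2)))).mul h3).aestronglyMeasurable
    · refine Eventually.of_forall fun x => ?_
      rw [norm_mul, norm_mul]
      refine mul_le_mul_of_nonneg_right ?_ (norm_nonneg _)
      rw [Real.norm_eq_abs, Real.norm_of_nonneg (by positivity)]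
      refine (abs_add_le _ _).trans (add_le_add_right ?_ _)
      rw [abs_mul, abs_of_nonneg (a := x i ^ 2 / ‖x‖ ^ 2) (by positivity)]
      exact mul_le_of_le_one_right (abs_nonneg _) (hcoord i x)
  have hF : ∀ i, Continuous fun x : EuclideanSpace ℝ (Fin N) => H ‖x‖ * x i := fun i => by
    fun_prop
  have hI2 : ∀ i, Integrable fun x : EuclideanSpace ℝ (Fin N) =>
      H ‖x‖ * x i * fderiv ℝ φ x (e i) := fun i =>
    ((hF i).mul (hdφ.clm_apply continuous_const)).integrable_of_hasCompactSupport
      (hdφc (e i)).mul_left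
  have hI3 : ∀ i, Integrable fun x : EuclideanSpace ℝ (Fin N) => H ‖x‖ * x i * φ x := fun i =>
    ((hF i).mul hφ.continuous).integrable_of_hasCompactSupport hφc.mul_left
  have hibp : ∀ i, ∫ x : EuclideanSpace ℝ (Fin N), H ‖x‖ * x i * fderiv ℝ φ x (e i) =
      -∫ x, D i x * φ x := fun i =>
    integral_bilinear_hasLineDerivAt_right_eq_neg_left_of_integrable
      (B := ContinuousLinearMap.mul ℝ ℝ) (hI1 i) (hI2 i) (hI3 i)
      (fun x _ => hasLineDerivAt_meanValue_norm_mul hy x i)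
      (fun x _ => ((hφ.differentiable one_ne_zero) x).hasFDerivAt.hasLineDerivAt (e i))
  have hexp : ∀ x, inner ℝ (-(H ‖x‖) • x) (gradient φ x) =
      -∑ i, H ‖x‖ * x i * fderiv ℝ φ x (e i) := by
    intro x
    have hx : x = ∑ i, x i • e i := by
      have := (EuclideanSpace.basisFun (Fin N) ℝ).sum_repr x
      simpa [e] using this.symm
    have h1 : fderiv ℝ φ x x = ∑ i, x i * fderiv ℝ φ x (e i) := by
      conv_lhs => rw [hx]
      rw [map_sum]
      simp only [map_smul, smul_eq_mul]
      rw [← hx]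
    rw [inner_smul_left, real_inner_comm, gradient, InnerProductSpace.toDual_symm_apply, h1,
      Finset.mul_sum, ← Finset.sum_neg_distrib]
    refine Finset.sum_congr rfl fun i _ => ?_
    simp [mul_assoc]
  simp_rw [hexp]
  rw [integral_neg, integral_finsetSum _ fun i _ => hI2 i]
  simp_rw [hibp]
  rw [Finset.sum_neg_distrib, neg_neg, ← integral_finsetSum _ fun i _ => hI1 i]
  refine integral_mono (integrable_finsetSum _ fun i _ => hI1 i) ?_ fun x => ?_
  · have hc : Continuous fun x : EuclideanSpace ℝ (Fin N) => (N : ℝ) * y ‖x‖ * φ x := by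
      have := hφ.continuous
      fun_prop
    exact hc.integrable_of_hasCompactSupport hφc.mul_left
  · simp only
    rw [← Finset.sum_mul]
    refine mul_le_mul_of_nonneg_right ?_ (hφ0 x)
    have hle : H ‖x‖ ≤ y ‖x‖ := meanValue_le hy hmono (norm_nonneg x)
    have hN' : (1 : ℝ) ≤ N := by exact_mod_cast hN
    -- Only an inequality: the sum is `0` at the origin. It suffices because `y - H ≥ 0`.
    have hs : ∑ i, x i ^ 2 / ‖x‖ ^ 2 ≤ 1 := by
      rw [← Finset.sum_div, ← EuclideanSpace.real_norm_sq_eq]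
      exact div_self_le_one _
    simp only [D]
    rw [Finset.sum_add_distrib, ← Finset.mul_sum, Finset.sum_const, Finset.card_univ,
      Fintype.card_fin, nsmul_eq_mul]
    have hs0 : (y ‖x‖ - H ‖x‖) * ∑ i, x i ^ 2 / ‖x‖ ^ 2 ≤ y ‖x‖ - H ‖x‖ :=
      mul_le_of_le_one_right (sub_nonneg.2 hle) hs
    nlinarith [mul_nonneg (sub_nonneg.2 hN') (sub_nonneg.2 hle)]

end meanValue

/-! ### Strict monotonicity of the `p`-Laplace flux -/

section flux

variable {E : Type*} [NormedAddCommGroup E] [InnerProductSpace ℝ E] {p : ℝ}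

lemma rpow_sub_two_mul_self (hp : 1 < p) {s : ℝ} (hs : 0 ≤ s) : s ^ (p - 2) * s = s ^ (p - 1) := by
  rcases hs.eq_or_lt with rfl | hs
  · rw [mul_zero, Real.zero_rpow (by linarith)]
  · rw [← Real.rpow_add_one hs.ne']
    congr 1
    ring

lemma norm_flux (hp : 1 < p) (a : E) : ‖‖a‖ ^ (p - 2) • a‖ = ‖a‖ ^ (p - 1) := by
  rw [norm_smul, Real.norm_of_nonneg (Real.rpow_nonneg (norm_nonneg _) _),
    rpow_sub_two_mul_self hp (norm_nonneg _)]

lemma continuous_flux (hp : 1 < p) : Continuous fun a : E => ‖a‖ ^ (p - 2) • a := by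
  refine continuous_iff_continuousAt.2 fun a => ?_
  rcases eq_or_ne a 0 with rfl | ha
  · rw [ContinuousAt, smul_zero, tendsto_zero_iff_norm_tendsto_zero]
    simp_rw [norm_flux hp]
    have h : Continuous fun a : E => ‖a‖ ^ (p - 1) :=
      continuous_norm.rpow_const fun _ => Or.inr (by linarith)
    have h0 := h.tendsto 0
    rwa [norm_zero, Real.zero_rpow (by linarith)] at h0
  · exact (continuous_norm.continuousAt.rpow_const (Or.inl (norm_ne_zero_iff.2 ha))).smul
      continuousAt_id

/-- The two sides differ by `(‖a‖^{p-2} + ‖b‖^{p-2})(‖a‖‖b‖ - ⟨a, b⟩)`, which Cauchy–Schwarz makes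
nonnegative. -/
lemma le_inner_flux_sub (hp : 1 < p) (a b : E) :
    (‖a‖ ^ (p - 1) - ‖b‖ ^ (p - 1)) * (‖a‖ - ‖b‖) ≤
      inner ℝ (‖a‖ ^ (p - 2) • a - ‖b‖ ^ (p - 2) • b) (a - b) := by
  have h1 := real_inner_le_norm a b
  have hα : 0 ≤ ‖a‖ ^ (p - 2) := Real.rpow_nonneg (norm_nonneg _) _
  have hβ : 0 ≤ ‖b‖ ^ (p - 2) := Real.rpow_nonneg (norm_nonneg _) _
  rw [← rpow_sub_two_mul_self hp (norm_nonneg a), ← rpow_sub_two_mul_self hp (norm_nonneg b),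
    inner_sub_left, inner_sub_right, inner_sub_right, real_inner_smul_left, real_inner_smul_left,
    real_inner_smul_left, real_inner_smul_left, real_inner_self_eq_norm_sq,
    real_inner_self_eq_norm_sq, real_inner_comm a b]
  nlinarith [mul_le_mul_of_nonneg_left h1 (add_nonneg hα hβ)]

lemma rpow_sub_mul_sub_nonneg (hp : 1 < p) {s t : ℝ} (hs : 0 ≤ s) (ht : 0 ≤ t) :
    0 ≤ (s ^ (p - 1) - t ^ (p - 1)) * (s - t) := by
  have hp1 : 0 ≤ p - 1 := by linarith
  rcases le_total s t with h | h
  · exact mul_nonneg_of_nonpos_of_nonpos (sub_nonpos.2 (Real.rpow_le_rpow hs h hp1))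
      (sub_nonpos.2 h)
  · exact mul_nonneg (sub_nonneg.2 (Real.rpow_le_rpow ht h hp1)) (sub_nonneg.2 h)

lemma inner_flux_sub_nonneg (hp : 1 < p) (a b : E) :
    0 ≤ inner ℝ (‖a‖ ^ (p - 2) • a - ‖b‖ ^ (p - 2) • b) (a - b) :=
  (rpow_sub_mul_sub_nonneg hp (norm_nonneg _) (norm_nonneg _)).trans (le_inner_flux_sub hp a b)

lemma eq_of_inner_flux_sub_eq_zero (hp : 1 < p) {a b : E}
    (h : inner ℝ (‖a‖ ^ (p - 2) • a - ‖b‖ ^ (p - 2) • b) (a - b) = 0) : a = b := by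
  have hp1 : 0 < p - 1 := by linarith
  have h0 : (‖a‖ ^ (p - 1) - ‖b‖ ^ (p - 1)) * (‖a‖ - ‖b‖) = 0 :=
    le_antisymm (h ▸ le_inner_flux_sub hp a b)
      (rpow_sub_mul_sub_nonneg hp (norm_nonneg _) (norm_nonneg _))
  have hab : ‖a‖ = ‖b‖ := by
    rcases mul_eq_zero.1 h0 with h1 | h1
    · exact (Real.rpow_left_inj (norm_nonneg _) (norm_nonneg _) hp1.ne').1 (sub_eq_zero.1 h1)
    · exact sub_eq_zero.1 h1
  rw [hab, ← smul_sub, real_inner_smul_left, mul_eq_zero] at h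
  rcases h with h | h
  · have hb : ‖b‖ = 0 := by
      by_contra hb
      exact (Real.rpow_pos_of_pos (lt_of_le_of_ne (norm_nonneg _) (Ne.symm hb)) _).ne' h
    rw [norm_eq_zero.1 (hab.trans hb), norm_eq_zero.1 hb]
  · exact sub_eq_zero.1 (inner_self_eq_zero.1 h)

/-- The flux of a radial field pointing inward with modulus `w ≥ 0`. -/
lemma flux_radial (hp : 1 < p) {s : ℝ} (hs : 0 ≤ s) {x : E} (hx : x ≠ 0) :
    ‖-(s / ‖x‖) • x‖ ^ (p - 2) • (-(s / ‖x‖) • x) = -(s ^ (p - 1) / ‖x‖) • x := by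
  have hx' : ‖x‖ ≠ 0 := norm_ne_zero_iff.2 hx
  have h1 : ‖-(s / ‖x‖) • x‖ = s := by
    rw [norm_smul, norm_neg, norm_div, norm_norm, div_mul_cancel₀ _ hx', Real.norm_of_nonneg hs]
  rw [h1, smul_smul, ← rpow_sub_two_mul_self hp hs]
  congr 1
  ring

end flux

/-! ### Weak comparison on a ball -/

lemma hasDerivAt_sq_max (s : ℝ) : HasDerivAt (fun s : ℝ => max s 0 ^ 2) (2 * max s 0) s := by
  refine hasDerivAt_of_hasDerivAt_of_ne' (x := 0) (g := fun s => 2 * max s 0) (fun s hs => ?_)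
    (by fun_prop) (by fun_prop) s
  rcases hs.lt_or_gt with hs | hs
  · rw [max_eq_right hs.le, mul_zero]
    refine (hasDerivAt_const s (0 : ℝ)).congr_of_eventuallyEq ?_
    filter_upwards [Iio_mem_nhds hs] with t ht
    simp [max_eq_right (le_of_lt (mem_Iio.1 ht))]
  · rw [max_eq_left hs.le]
    have h := hasDerivAt_pow 2 s
    refine (h.congr_deriv (by simp)).congr_of_eventuallyEq ?_
    filter_upwards [Ioi_mem_nhds hs] with t ht
    simp [max_eq_left (le_of_lt (mem_Ioi.1 ht))]

/-- Squaring the positive part makes it `C¹`, hence admissible in a test function. -/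
lemma contDiff_sq_max : ContDiff ℝ 1 fun s : ℝ => max s 0 ^ 2 := by
  rw [contDiff_one_iff_deriv]
  refine ⟨fun s => (hasDerivAt_sq_max s).differentiableAt, ?_⟩
  rw [show deriv (fun s : ℝ => max s 0 ^ 2) = fun s => 2 * max s 0 from
    funext fun s => (hasDerivAt_sq_max s).deriv]
  fun_prop

/-- The truncated test function `((v - u)⁺)²` on the ball of radius `R`, extended by zero. -/
noncomputable def truncSq {N : ℕ} (u v : EuclideanSpace ℝ (Fin N) → ℝ) (R : ℝ)
    (x : EuclideanSpace ℝ (Fin N)) : ℝ :=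
  if ‖x‖ < R then max (v x - u x) 0 ^ 2 else 0

section comparison

variable {N : ℕ} {u v : EuclideanSpace ℝ (Fin N) → ℝ} {r R : ℝ}

lemma truncSq_nonneg (x : EuclideanSpace ℝ (Fin N)) : 0 ≤ truncSq u v R x := by
  unfold truncSq
  split_ifs <;> positivity

lemma lt_of_truncSq_ne_zero {x : EuclideanSpace ℝ (Fin N)} (h : truncSq u v R x ≠ 0) :
    u x < v x := by
  by_contra hx
  apply h
  unfold truncSq
  split_ifs
  · rw [max_eq_right (by linarith)]
    norm_num
  · rfl

lemma hasCompactSupport_truncSq : HasCompactSupport (truncSq u v R) :=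
  HasCompactSupport.intro (isCompact_closedBall (0 : EuclideanSpace ℝ (Fin N)) R) fun x hx => by
    have hx : R < ‖x‖ := by simpa using hx
    exact if_neg hx.not_gt

lemma truncSq_eventuallyEq {x : EuclideanSpace ℝ (Fin N)} (hx : ‖x‖ < R) :
    truncSq u v R =ᶠ[𝓝 x] fun x => max (v x - u x) 0 ^ 2 := by
  filter_upwards [(isOpen_lt continuous_norm continuous_const).mem_nhds hx] with y hy
  exact if_pos hy

lemma truncSq_eventuallyEq_zero (hle : ∀ x, r < ‖x‖ → ‖x‖ < R → v x ≤ u x)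
    {x : EuclideanSpace ℝ (Fin N)} (hx : r < ‖x‖) : truncSq u v R =ᶠ[𝓝 x] fun _ => 0 := by
  filter_upwards [(isOpen_lt continuous_const continuous_norm).mem_nhds hx] with y hy
  by_contra h
  have h2 := lt_of_truncSq_ne_zero h
  by_cases hyR : ‖y‖ < R
  · exact (hle y hy hyR).not_gt h2
  · exact h (if_neg hyR)

/-- The function already vanishes on the annulus `r < ‖x‖ < R`, so the extension by zero glues
smoothly. -/
lemma contDiff_truncSq (hu : ContDiff ℝ 1 u) (hv : ContDiff ℝ 1 v) (hrR : r < R)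
    (hle : ∀ x, r < ‖x‖ → ‖x‖ < R → v x ≤ u x) : ContDiff ℝ 1 (truncSq u v R) := by
  rw [contDiff_iff_contDiffAt]
  intro x
  by_cases hx : ‖x‖ < R
  · exact (contDiff_sq_max.comp (hv.sub hu)).contDiffAt.congr_of_eventuallyEq
      (truncSq_eventuallyEq hx)
  · exact contDiffAt_const.congr_of_eventuallyEq
      (truncSq_eventuallyEq_zero hle (hrR.trans_le (not_lt.1 hx)))

lemma gradient_truncSq (hu : ContDiff ℝ 1 u) (hv : ContDiff ℝ 1 v)
    {x : EuclideanSpace ℝ (Fin N)} (hx : ‖x‖ < R) :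
    gradient (truncSq u v R) x =
      (2 * max (v x - u x) 0) • (gradient v x - gradient u x) := by
  have h1 := ((hv.differentiable one_ne_zero) x).hasFDerivAt.sub
    ((hu.differentiable one_ne_zero) x).hasFDerivAt
  have h2 := ((hasDerivAt_sq_max (v x - u x)).comp_hasFDerivAt x h1).congr_of_eventuallyEq
    (truncSq_eventuallyEq hx)
  rw [gradient, h2.fderiv, map_smul, map_sub]
  rfl

lemma gradient_truncSq_of_le (hrR : r < R) (hle : ∀ x, r < ‖x‖ → ‖x‖ < R → v x ≤ u x)
    {x : EuclideanSpace ℝ (Fin N)} (hx : R ≤ ‖x‖) : gradient (truncSq u v R) x = 0 := by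
  rw [gradient, (truncSq_eventuallyEq_zero hle (hrR.trans_le hx)).fderiv_eq]
  simp

lemma continuous_pLaplaceFlux {p : ℝ} (hp : 1 < p) (hu : ContDiff ℝ 1 u) :
    Continuous (pLaplaceFlux p u) :=
  (continuous_flux hp).comp (continuous_gradient hu)

/-- Comparison principle for the `p`-Laplacian on a ball, in the form needed at its centre. -/
theorem le_of_weak_comparison {p : ℝ} (hp : 1 < p) (hN : 0 < N) (hu : ContDiff ℝ 1 u)
    (hv : ContDiff ℝ 1 v) (hR : 0 < R) (hrR : r < R)
    (hle : ∀ x, r < ‖x‖ → ‖x‖ < R → v x ≤ u x)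
    (hweak : ∀ φ : EuclideanSpace ℝ (Fin N) → ℝ, ContDiff ℝ 1 φ → HasCompactSupport φ →
      (∀ x, 0 ≤ φ x) → (∀ x, φ x ≠ 0 → u x < v x) →
      ∫ x, inner ℝ (pLaplaceFlux p v x) (gradient φ x) ≤
        ∫ x, inner ℝ (pLaplaceFlux p u x) (gradient φ x)) : v 0 ≤ u 0 := by
  have hφ := contDiff_truncSq hu hv hrR hle
  have hφc : HasCompactSupport (truncSq u v R) := hasCompactSupport_truncSq
  have hw := hweak _ hφ hφc truncSq_nonneg fun x => lt_of_truncSq_ne_zero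
  set φ := truncSq u v R with hφdef
  have hgc : HasCompactSupport (gradient φ) :=
    (hφc.fderiv ℝ).comp_left (g := (InnerProductSpace.toDual ℝ _).symm) (map_zero _)
  have hint : ∀ w : EuclideanSpace ℝ (Fin N) → ℝ, ContDiff ℝ 1 w →
      Continuous (fun x => inner ℝ (pLaplaceFlux p w x) (gradient φ x)) ∧
        HasCompactSupport (fun x => inner ℝ (pLaplaceFlux p w x) (gradient φ x)) := by
    intro w hw
    refine ⟨(continuous_pLaplaceFlux hp hw).inner (continuous_gradient hφ), ?_⟩
    refine hgc.mono fun x hx => ?_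
    contrapose! hx
    rw [Function.notMem_support] at hx ⊢
    rw [hx, inner_zero_right]
  set T : EuclideanSpace ℝ (Fin N) → ℝ := fun x =>
    inner ℝ (pLaplaceFlux p v x) (gradient φ x) - inner ℝ (pLaplaceFlux p u x) (gradient φ x)
    with hT
  have hTx : ∀ x, ‖x‖ < R → T x = (2 * max (v x - u x) 0) *
      inner ℝ (pLaplaceFlux p v x - pLaplaceFlux p u x) (gradient v x - gradient u x) := by
    intro x hx
    rw [hT]
    simp only
    rw [← inner_sub_left, hφdef, gradient_truncSq hu hv hx, real_inner_smul_right]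
  have hTc : Continuous T := (hint v hv).1.sub (hint u hu).1
  have hTs : HasCompactSupport T := (hint v hv).2.sub (hint u hu).2
  have hT0 : 0 ≤ T := by
    intro x
    by_cases hx : ‖x‖ < R
    · rw [hTx x hx]
      exact mul_nonneg (by positivity) (inner_flux_sub_nonneg hp _ _)
    · have h : gradient φ x = 0 := gradient_truncSq_of_le hrR hle (not_lt.1 hx)
      simp only [hT, h, inner_zero_right, sub_self, Pi.zero_apply, le_refl]
  have hTint : ∫ x, T x ≤ 0 := by
    rw [hT, integral_sub ((hint v hv).1.integrable_of_hasCompactSupport (hint v hv).2)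
      ((hint u hu).1.integrable_of_hasCompactSupport (hint u hu).2)]
    linarith
  have hTz : ∀ x, T x = 0 := fun x => by
    by_contra hx
    exact (hTc.integral_pos_of_hasCompactSupport_nonneg_nonzero hTs hT0 hx).not_ge hTint
  -- Inside the ball, `T x = 0` forces `(v - u)⁺ = 0` or `∇v = ∇u`; both kill `∇φ`.
  have hg : ∀ x, gradient φ x = 0 := by
    intro x
    by_cases hx : ‖x‖ < R
    · have h := hTz x
      rw [hTx x hx, mul_eq_zero] at h
      rw [hφdef, gradient_truncSq hu hv hx]
      rcases h with h | h
      · rw [h, zero_smul]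
      · rw [eq_of_inner_flux_sub_eq_zero hp h, sub_self, smul_zero]
    · exact gradient_truncSq_of_le hrR hle (not_lt.1 hx)
  have hconst := is_const_of_fderiv_eq_zero (hφ.differentiable one_ne_zero) fun x => by
    have := hg x
    rwa [gradient, map_eq_zero_iff _ (LinearIsometryEquiv.injective _)] at this
  -- A point on the sphere of radius `R`, where the constant `φ` is zero; it exists because `N > 0`.
  have hfar : φ (EuclideanSpace.single ⟨0, hN⟩ R) = 0 := if_neg (by simp [le_abs_self])
  have h0 := hconst 0 (EuclideanSpace.single ⟨0, hN⟩ R)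
  rw [hfar] at h0
  by_contra hlt
  have hlt : 0 < v 0 - u 0 := by linarith
  rw [hφdef, truncSq, if_pos (by simpa using hR), max_eq_left hlt.le] at h0
  exact (pow_pos hlt 2).ne' h0

end comparison

/-! ### Uniform radius and radial subsolution -/

/-- The Keller–Osserman condition bounds the radius of every barrier starting above `-1`. -/
lemma exists_radius {p c a : ℝ} {f : ℝ → ℝ} (hp : 1 < p) (hc : 0 < c) (hf : Continuous f)
    (hanti : Antitone f) (hpos : ∀ t, 0 < f t) (hKO : KellerOssermanAtBot p f) (ha : -1 ≤ a) :
    ∃ R : ℝ, 0 ≤ R ∧ ∀ b ≤ -1, ∫ t in b..a, (c * ∫ s in t..a, f s) ^ (-(1 / p)) ≤ R := by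
  have hp0 : 0 < 1 / p := by positivity
  set k : ℝ → ℝ := fun t => (∫ s in t..(-1 : ℝ), f s) ^ (-(1 / p)) with hk
  have hI : ∀ t ≤ a, IntervalIntegrable (fun t => (c * ∫ s in t..a, f s) ^ (-(1 / p))) volume t a :=
    intervalIntegrable_integral_rpow hp hc hf hanti hpos
  have hkI : IntegrableOn k (Iio (-1)) := hKO
  -- Below `-1`, `∫_t^a f ≥ ∫_t^{-1} f` and the negative power reverses this, leaving the
  -- Keller–Osserman integral; the piece over `[-1, a]` does not involve `b`.
  refine ⟨max (c ^ (-(1 / p)) * (∫ t in Iio (-1), k t) +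
    ∫ t in (-1)..a, (c * ∫ s in t..a, f s) ^ (-(1 / p))) 0, le_max_right _ _, fun b hb => ?_⟩
  refine le_trans ?_ (le_max_left _ _)
  have hI1 : IntervalIntegrable (fun t => (c * ∫ s in t..a, f s) ^ (-(1 / p))) volume b (-1) :=
    (hI b (hb.trans ha)).trans (hI (-1) ha).symm
  rw [← intervalIntegral.integral_add_adjacent_intervals hI1 (hI (-1) ha)]
  refine add_le_add_left ?_ _
  have hsub : Ioo b (-1) ⊆ Iio (-1 : ℝ) := fun x hx => hx.2
  rw [intervalIntegral.integral_of_le hb, integral_Ioc_eq_integral_Ioo, ← integral_const_mul]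
  have hck : IntegrableOn (fun t => c ^ (-(1 / p)) * k t) (Iio (-1)) := hkI.const_mul _
  have hk0 : ∀ t < -1, 0 < ∫ s in t..(-1 : ℝ), f s := fun t ht =>
    integral_left_pos hf hanti hpos ht
  calc ∫ t in Ioo b (-1), (c * ∫ s in t..a, f s) ^ (-(1 / p))
      ≤ ∫ t in Ioo b (-1), c ^ (-(1 / p)) * k t := by
        refine setIntegral_mono_on
          ((intervalIntegrable_iff_integrableOn_Ioo_of_le hb).1 hI1) (hck.mono_set hsub)
          measurableSet_Ioo fun t ht => ?_
        have h0 := hk0 t ht.2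
        have h1 := intervalIntegral.integral_add_adjacent_intervals (μ := volume)
          (hf.intervalIntegrable t (-1)) (hf.intervalIntegrable (-1) a)
        have h2 : 0 ≤ ∫ s in (-1)..a, f s :=
          intervalIntegral.integral_nonneg ha fun s _ => (hpos s).le
        rw [hk, ← Real.mul_rpow hc.le h0.le]
        exact Real.rpow_le_rpow_of_nonpos (mul_pos hc h0)
          (mul_le_mul_of_nonneg_left (by linarith) hc.le) (by linarith)
    _ ≤ ∫ t in Iio (-1), c ^ (-(1 / p)) * k t := by
        refine setIntegral_mono_set hck ?_ hsub.eventuallyLE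
        rw [EventuallyLE, ae_restrict_iff' measurableSet_Iio]
        exact Eventually.of_forall fun t ht =>
          mul_nonneg (Real.rpow_nonneg hc.le _) (Real.rpow_nonneg (hk0 t ht).le _)

/-- A radial `C¹` weak subsolution of `-div(|∇v|^{p-2} ∇v) = g(v)` on the whole space, equal to `a`
at the origin and at most `b` outside an explicit ball. -/
theorem exists_radial_subsolution {p a : ℝ} {g : ℝ → ℝ} {N : ℕ} (hp : 1 < p) (hN : 1 ≤ N)
    (hg : Continuous g) (hanti : Antitone g) (hpos : ∀ t, 0 < g t) {M : ℝ} (hM : ∀ t, g t ≤ M) :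
    ∃ v : EuclideanSpace ℝ (Fin N) → ℝ, ContDiff ℝ 1 v ∧ v 0 = a ∧
      (∀ φ : EuclideanSpace ℝ (Fin N) → ℝ, ContDiff ℝ 1 φ → HasCompactSupport φ →
        (∀ x, 0 ≤ φ x) →
        ∫ x, inner ℝ (pLaplaceFlux p v x) (gradient φ x) ≤ ∫ x, g (v x) * φ x) ∧
      ∀ b ≤ a, ∀ x, ∫ t in b..a, (p / ((p - 1) * N) * ∫ s in t..a, g s) ^ (-(1 / p)) ≤ ‖x‖ →
        v x ≤ b := by
  have hN0 : (0 : ℝ) < N := by exact_mod_cast hN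
  have hp1 : 0 < p - 1 := by linarith
  have hp0 : 0 < 1 / p := by positivity
  have hc : 0 < p / ((p - 1) * N) := by positivity
  obtain ⟨V, hVc, hV0, hVanti, hVlt, hV, hVb⟩ := exists_profile (a := a) hp hc hg hanti hpos hM
  have hflux : ∀ r, 0 ≤ r → ∫ s in (0 : ℝ)..r, g (V s) / N =
      ((p / ((p - 1) * N) * ∫ s in V r..a, g s) ^ (1 / p)) ^ (p - 1) := fun r hr =>
    integral_comp_profile hp hN0 hg hanti hpos hVc hV0 hVlt hV hr
  set c := p / ((p - 1) * N)
  set w : ℝ → ℝ := fun r => (c * ∫ s in V r..a, g s) ^ (1 / p) with hw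
  have hw0 : w 0 = 0 := by
    simp only [hw, hV0, intervalIntegral.integral_same, mul_zero, Real.zero_rpow hp0.ne']
  have hwc : Continuous w :=
    (((continuous_integral_left hg).comp hVc).const_mul c).rpow_const fun _ => Or.inr hp0.le
  have hVa : ∀ r, 0 ≤ r → V r ≤ a := fun r hr => hV0 ▸ hVanti hr
  have hwn : ∀ r, 0 ≤ r → 0 ≤ w r := fun r hr => by
    refine Real.rpow_nonneg (mul_nonneg hc.le ?_) _
    exact intervalIntegral.integral_nonneg (hVa r hr) fun s _ => (hpos s).le
  have hgrad := hasGradientAt_comp_norm (E := EuclideanSpace ℝ (Fin N)) hV hw0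
  set y : ℝ → ℝ := fun r => g (V r) / N
  have hyc : Continuous y := (hg.comp hVc).div_const _
  have hym : Monotone y := fun r s hrs =>
    div_le_div_of_nonneg_right (hanti (hVanti hrs)) hN0.le
  have hF : ∀ x : EuclideanSpace ℝ (Fin N),
      pLaplaceFlux p (fun x => V ‖x‖) x = -(meanValue y ‖x‖) • x := by
    intro x
    rw [pLaplaceFlux, (hgrad x).gradient]
    rcases eq_or_ne x 0 with rfl | hx
    · simp
    · rw [flux_radial hp (hwn _ (norm_nonneg x)) hx, meanValue_eq_div (norm_ne_zero_iff.2 hx),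
        hflux _ (norm_nonneg x)]
  refine ⟨fun x => V ‖x‖, contDiff_one_of_hasGradientAt hgrad (continuous_radial_field hwc hw0),
    by simpa using hV0, fun φ hφ hφc hφ0 => ?_, fun b hb x hx => hVb b _ hb hx⟩
  simp_rw [hF]
  refine (integral_inner_radial_le hN hyc hym hφ hφc hφ0).trans (le_of_eq ?_)
  refine integral_congr_ae (Eventually.of_forall fun x => ?_)
  simp only [y]
  rw [mul_div_cancel₀ _ hN0.ne']

end KellerOsserman

/-! ### The contradiction -/

open KellerOsserman in
theorem mainTheorem7 (p : ℝ) (hp : 1 < p) (N : ℕ) (hN : 1 < N) (f : ℝ → ℝ)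
    (hf_cont : Continuous f) (hf_pos : ∀ t, 0 < f t) (hf_anti : Antitone f)
    (hf_KO : KellerOssermanAtBot p f) :
    ¬ ∃ u : EuclideanSpace ℝ (Fin N) → ℝ, IsWeakSolutionPLaplaceGE p f u := by
  rintro ⟨u, hu, hweak⟩
  have hN0 : (0 : ℝ) < N := by exact_mod_cast (zero_lt_one.trans hN)
  have hp1 : 0 < p - 1 := by linarith
  have hc : 0 < p / ((p - 1) * N) := by positivity
  set a := |u 0| + 1 with ha_def
  have ha : -1 ≤ a := by linarith [abs_nonneg (u 0)]
  obtain ⟨R, hR0, hR⟩ := exists_radius hp hc hf_cont hf_anti hf_pos hf_KO ha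
  obtain ⟨x₀, -, hx₀⟩ := (isCompact_closedBall (0 : EuclideanSpace ℝ (Fin N)) (R + 1)).exists_isMinOn
    ⟨0, by simp; linarith⟩ hu.continuous.continuousOn
  -- `R` does not depend on `b`, so there is no circularity in taking `b` below `u` on the ball of
  -- radius `R + 1`.
  set b := min (u x₀) (-1) with hb_def
  have hb1 : b ≤ -1 := min_le_right _ _
  have hba : b ≤ a := hb1.trans ha
  set g : ℝ → ℝ := fun t => f (max t b) with hg_def
  have hgc : Continuous g := by fun_prop
  have hganti : Antitone g := fun s t hst => hf_anti (max_le_max hst le_rfl)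
  obtain ⟨v, hv, hv0, hvweak, hvb⟩ := exists_radial_subsolution (a := a) (N := N) hp hN.le hgc
    hganti (fun t => hf_pos _) (M := f b) (fun t => hf_anti (le_max_right _ _))
  have hint : ∫ t in b..a, (p / ((p - 1) * N) * ∫ s in t..a, g s) ^ (-(1 / p)) ≤ R := by
    refine le_trans (le_of_eq ?_) (hR b hb1)
    refine intervalIntegral.integral_congr fun t ht => ?_
    rw [uIcc_of_le hba] at ht
    have : ∫ s in t..a, g s = ∫ s in t..a, f s := by
      refine intervalIntegral.integral_congr fun s hs => ?_
      rw [uIcc_of_le ht.2] at hs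
      simp only [hg_def, max_eq_left (ht.1.trans hs.1)]
    simp only [this]
  have hle : ∀ x, R < ‖x‖ → ‖x‖ < R + 1 → v x ≤ u x := fun x h1 h2 =>
    (hvb b hba x (hint.trans h1.le)).trans
      ((min_le_left _ _).trans (hx₀ (by simpa using h2.le)))
  have h := le_of_weak_comparison hp (zero_lt_one.trans hN) hu hv (by linarith) (lt_add_one R) hle
    fun φ hφ hφc hφ0 hφlt => by
      refine (hvweak φ hφ hφc hφ0).trans (le_trans ?_ (hweak φ hφ hφc hφ0))
      refine integral_mono
        (((hgc.comp hv.continuous).mul hφ.continuous).integrable_of_hasCompactSupport hφc.mul_left)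
        (((hf_cont.comp hu.continuous).mul hφ.continuous).integrable_of_hasCompactSupport
          hφc.mul_left) fun x => ?_
      rcases eq_or_ne (φ x) 0 with h0 | h0
      · simp [h0]
      -- Where `φ ≠ 0`, `u < v ≤ max v b`, so monotonicity of `f` gives `g(v) ≤ f(u)`.
      · exact mul_le_mul_of_nonneg_right
          (hf_anti ((hφlt x h0).le.trans (le_max_left _ _))) (hφ0 x)
  rw [hv0] at h
  linarith [le_abs_self (u 0)]
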